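/- For an integer polynomial $f$ let $H(f)$ (its height) be the largest absolute value of its coefficients. Let $A_n=H(\Phi_n)$ be the height of the $n$-th cyclotomic polynomial $\Phi_n$, let $S_n$ be the sum of the absolute values of the coefficients of $\Phi_n$, and let $B_n$ be the largest height of a divisor of $x^n-1$ in $\mathbb{Z}[x]$. Let $\epsilon_3$ be the smallest positive real number such that $A_{pqr}\le \epsilon_3\,p$ for all distinct primes $p,q,r$, and put $$d=\sup_{p,q,r}\frac{S_{pqr}}{p^2qr},\qquad \rho=\prod_{i=0}^{\infty}\left(\frac{2i+5}{2i+6}\right)^{1/2^i},\qquad C=\left(\frac34\,\epsilon_3^{3/2}\,d\,\rho^{1/4}\right)^{1/32},$$ where the supremum is over all distinct primes $p,q,r$. Theorem. There is a sequence of real numbers $\xi_k\to 0$ with $C+\xi_k>0$ for all $k$ such that, for every squarefree integer $n>1$, with $k$ the number of prime factors of $n$, the number $\eta$ defined by $$B_n=\eta\, n^{(3^k-1)/(2k)-1}$$ satisfies $$\log\eta<3^k\log(C+\xi_k).$$ (That is, $\log \eta_k<3^k\log(C+o(1))$ as $k\to\infty$, uniformly in $n$.) -/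

import Mathlib

open Filter Topology Polynomial

noncomputable section

namespace CyclotomicHeight

/-- The height `H(f)` of an integer polynomial: the largest absolute value of a coefficient. -/
def height (f : ℤ[X]) : ℕ := f.support.sup fun m => (f.coeff m).natAbs

/-- The length `S(f)` of an integer polynomial: the sum of the absolute values of its
coefficients. -/
def length (f : ℤ[X]) : ℕ := ∑ m ∈ f.support, (f.coeff m).natAbs

/-- `A n`, the height of the `n`-th cyclotomic polynomial. -/
def A (n : ℕ) : ℕ := height (cyclotomic n ℤ)

/-- `S n`, the sum of the absolute values of the coefficients of the `n`-th cyclotomic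
polynomial. -/
def S (n : ℕ) : ℕ := length (cyclotomic n ℤ)

/-- `B n`, the largest height of a divisor of `x ^ n - 1` in `ℤ[x]`. For `n ≥ 1` there are only
finitely many divisors, so that this supremum is a maximum. -/
def B (n : ℕ) : ℕ := sSup {h : ℕ | ∃ g : ℤ[X], g ∣ X ^ n - 1 ∧ height g = h}

/-- `ε₃`, the smallest positive real number with `A (p * q * r) ≤ ε₃ * p` for all distinct primes
`p`, `q`, `r` (in any order). -/
def epsilonThree : ℝ :=
  sInf {e : ℝ | 0 < e ∧ ∀ p q r : ℕ, p.Prime → q.Prime → r.Prime → p ≠ q → p ≠ r → q ≠ r →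
    (A (p * q * r) : ℝ) ≤ e * p}

/-- `d`, the supremum of `S (p * q * r) / (p ^ 2 * q * r)` over all distinct primes
`p`, `q`, `r` (in any order). -/
def d : ℝ :=
  sSup {x : ℝ | ∃ p q r : ℕ, p.Prime ∧ q.Prime ∧ r.Prime ∧ p ≠ q ∧ p ≠ r ∧ q ≠ r ∧
    x = (S (p * q * r) : ℝ) / ((p : ℝ) ^ 2 * q * r)}

/-- `ρ = ∏_{i ≥ 0} ((2 i + 5) / (2 i + 6)) ^ (1 / 2 ^ i)`. -/
def rho : ℝ := ∏' i : ℕ, ((2 * (i : ℝ) + 5) / (2 * (i : ℝ) + 6)) ^ ((1 : ℝ) / 2 ^ i)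

/-- `C = ((3 / 4) ε₃ ^ (3 / 2) d ρ ^ (1 / 4)) ^ (1 / 32)`. -/
def C : ℝ :=
  ((3 / 4 : ℝ) * epsilonThree ^ (3 / 2 : ℝ) * d * rho ^ (1 / 4 : ℝ)) ^ (1 / 32 : ℝ)

end CyclotomicHeight

end

namespace CyclotomicHeight

/-! ### Height and length of integer polynomials -/

/-! Up to sign, a divisor of x^n - 1 is a product of distinct Φ_i with i ∣ n. Since H(fg) ≤ S(f)
H(g), this gives B_n ≤ A_n ∏ S_i over the proper divisors i of n (`B_le`). It remains to bound S_i
and A_n by monomials in the primes.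

Write Ψ_l = (x^l - 1)/Φ_l and X_l = S(Φ_l) S(Ψ_l) (`lengthProd`). For primes p ≠ q not dividing l,
Φ_{pql} is Φ_l(x) Φ_l(x^{pq}) Ψ_l(x^p) Ψ_l(x^q) divided by (x^{lp} - 1)(x^{lq} - 1). Expanding the
quotient in geometric series, at most pq/2 terms have degree small enough to matter, so S_{pql} ≤
(pq/2) X_l^2 (`two_mul_S_le`). Also X_{pl} ≤ S_{pl} X_l. Together these give X_{pql} ≤ (pq/2) X_l^2
X_{pl}, a linear recursion for logarithms with roots 2 and -1. Started from two primes (constant 1)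
and three primes (constant d), it gives X_i growth exp(rate · 2^j) for j primes, with rate =
log(d/2)/12, and hence S_i growth exp((rate/2) 2^j), up to bounded factors.

Summing 2^j over the divisors of n gives 3^k, so the constant obtained is (d/2)^{1/24}. It is at
most C because d ≤ ε₃, ε₃ ≥ 2/3 and ρ ≥ (5/6)^2 (`exp_log_d_div_le_C`). The factor A_n only costs
exp(O(2^k)), and n A_n is bounded by the same kind of monomial as S_n, whence the -1 in the exponent
of n. In the product of all these monomials larger primes carry smaller exponents, so Chebyshev's
inequality replaces it by the power of n with the same total degree. -/

theorem natAbs_coeff_le_height (f : ℤ[X]) (m : ℕ) : (f.coeff m).natAbs ≤ height f := by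
  by_cases h : m ∈ f.support
  · exact Finset.le_sup (f := fun m => (f.coeff m).natAbs) h
  · simp [notMem_support_iff.mp h]

theorem height_le {f : ℤ[X]} {N : ℕ} (h : ∀ m, (f.coeff m).natAbs ≤ N) : height f ≤ N :=
  Finset.sup_le fun m _ => h m

theorem height_pos {f : ℤ[X]} (hf : f ≠ 0) : 0 < height f := by
  have h : 0 < (f.coeff f.natDegree).natAbs := by
    simpa [Int.natAbs_pos] using hf
  exact h.trans_le (natAbs_coeff_le_height f _)

theorem length_eq_sum {f : ℤ[X]} {s : Finset ℕ} (h : f.support ⊆ s) :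
    length f = ∑ m ∈ s, (f.coeff m).natAbs :=
  Finset.sum_subset h (by intro m _ hm; simp [notMem_support_iff.mp hm])

theorem sum_natAbs_coeff_le_length (f : ℤ[X]) (s : Finset ℕ) :
    ∑ m ∈ s, (f.coeff m).natAbs ≤ length f := by
  rw [length_eq_sum (f := f) (s := s ∪ f.support) Finset.subset_union_right]
  exact Finset.sum_le_sum_of_subset Finset.subset_union_left

theorem length_add_le (f g : ℤ[X]) : length (f + g) ≤ length f + length g := by
  rw [length_eq_sum (f := f + g) support_add, length_eq_sum (f := f) Finset.subset_union_left,
    length_eq_sum (f := g) Finset.subset_union_right, ← Finset.sum_add_distrib]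
  exact Finset.sum_le_sum fun m _ => by rw [coeff_add]; exact Int.natAbs_add_le _ _

theorem length_zero : length 0 = 0 := by simp [length]

theorem length_sum_le {ι : Type*} (s : Finset ι) (f : ι → ℤ[X]) :
    length (∑ i ∈ s, f i) ≤ ∑ i ∈ s, length (f i) :=
  Finset.le_sum_of_subadditive length length_zero.le length_add_le s f

theorem length_neg (f : ℤ[X]) : length (-f) = length f := by simp [length]

theorem length_sub_le (f g : ℤ[X]) : length (f - g) ≤ length f + length g := by
  rw [sub_eq_add_neg, ← length_neg g]
  exact length_add_le _ _

theorem length_monomial_mul_le (m : ℕ) (c : ℤ) (g : ℤ[X]) :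
    length (monomial m c * g) ≤ c.natAbs * length g := by
  have hs : (monomial m c * g).support ⊆ g.support.map (addRightEmbedding m) := by
    intro i hi
    rw [mem_support_iff, ← C_mul_X_pow_eq_monomial, mul_assoc, coeff_C_mul, coeff_X_pow_mul'] at hi
    split_ifs at hi with h
    · refine Finset.mem_map.mpr ⟨i - m, mem_support_iff.mpr (right_ne_zero_of_mul hi), ?_⟩
      simp [h]
    · simp at hi
  rw [length_eq_sum hs, Finset.sum_map, length, Finset.mul_sum]
  refine Finset.sum_le_sum fun i _ => ?_
  rw [addRightEmbedding_apply, coeff_monomial_mul, Int.natAbs_mul]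

theorem length_mul_le (f g : ℤ[X]) : length (f * g) ≤ length f * length g := by
  conv_lhs => rw [f.as_sum_support, Finset.sum_mul]
  refine (length_sum_le _ _).trans ?_
  rw [length, Finset.sum_mul]
  exact Finset.sum_le_sum fun i _ => length_monomial_mul_le _ _ _

theorem length_one : length 1 = 1 := by
  rw [← monomial_zero_one, length, support_monomial 0 one_ne_zero]; simp

theorem length_X_pow_le (m : ℕ) : length (X ^ m : ℤ[X]) ≤ 1 := by
  have := length_monomial_mul_le m 1 1
  rwa [monomial_one_right_eq_X_pow, mul_one, length_one] at this

theorem length_prod_le {ι : Type*} (s : Finset ι) (f : ι → ℤ[X]) :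
    length (∏ i ∈ s, f i) ≤ ∏ i ∈ s, length (f i) := by
  classical
  induction s using Finset.induction_on with
  | empty => simp [length_one]
  | insert a s ha ih =>
    rw [Finset.prod_insert ha, Finset.prod_insert ha]
    exact (length_mul_le _ _).trans (Nat.mul_le_mul_left _ ih)

theorem length_expand_le (p : ℕ) (f : ℤ[X]) : length (expand ℤ p f) ≤ length f := by
  rw [expand_eq_sum, Polynomial.sum]
  refine (length_sum_le _ _).trans (Finset.sum_le_sum fun i _ => ?_)
  have := length_monomial_mul_le (p * i) (f.coeff i) 1
  rwa [mul_one, length_one, mul_one, ← C_mul_X_pow_eq_monomial, pow_mul] at this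

theorem height_mul_le (f g : ℤ[X]) : height (f * g) ≤ length f * height g := by
  refine height_le fun m => ?_
  rw [coeff_mul, Finset.Nat.sum_antidiagonal_eq_sum_range_succ_mk]
  refine (Int.natAbs_sum_le _ _).trans ?_
  refine le_trans ?_ (Nat.mul_le_mul_right _ (sum_natAbs_coeff_le_length f (Finset.range m.succ)))
  rw [Finset.sum_mul]
  exact Finset.sum_le_sum fun i _ => by
    rw [Int.natAbs_mul]; exact Nat.mul_le_mul_left _ (natAbs_coeff_le_height _ _)

theorem height_le_length (f : ℤ[X]) : height f ≤ length f :=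
  height_le fun m => by simpa using sum_natAbs_coeff_le_length f {m}

theorem length_le_mul_height (f : ℤ[X]) : length f ≤ (f.natDegree + 1) * height f := by
  rw [length_eq_sum (s := Finset.range (f.natDegree + 1)) supp_subset_range_natDegree_succ]
  refine (Finset.sum_le_card_nsmul _ _ _ fun i _ => natAbs_coeff_le_height f i).trans ?_
  simp

theorem length_le_of_coeff_eq {f g : ℤ[X]} (h : ∀ m ≤ f.natDegree, f.coeff m = g.coeff m) :
    length f ≤ length g := by
  refine le_trans ?_ (sum_natAbs_coeff_le_length g f.support)
  exact (Finset.sum_congr rfl fun m hm => by rw [h m (le_natDegree_of_mem_supp m hm)]).le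

/-- The terms of `f(x ^ q)` times a geometric sum in `x ^ m` have distinct exponents. -/
theorem height_expand_mul_geom_le (f : ℤ[X]) {q m : ℕ} (hq : 0 < q) (h : q.Coprime m) :
    height (expand ℤ q f * ∑ a ∈ Finset.range q, X ^ (m * a)) ≤ height f := by
  refine height_le fun N => ?_
  rw [Finset.mul_sum, finsetSum_coeff]
  simp only [coeff_mul_X_pow', coeff_expand hq]
  -- At most one a < q contributes to the coefficient of x^N, because m is invertible modulo q.
  by_cases hz : ∃ a ∈ Finset.range q, m * a ≤ N ∧ q ∣ N - m * a
  · obtain ⟨a, ha, haN, had⟩ := hz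
    rw [Finset.sum_eq_single_of_mem a ha, if_pos haN, if_pos had]
    · exact natAbs_coeff_le_height _ _
    · intro b hb hba
      split_ifs with h1 h2
      · exfalso
        have e1 : m * a ≡ N [MOD q] := (Nat.modEq_iff_dvd' haN).mpr had
        have e2 : m * b ≡ N [MOD q] := (Nat.modEq_iff_dvd' h1).mpr h2
        have e3 := Nat.ModEq.cancel_left_of_coprime h (e2.trans e1.symm)
        exact hba (e3.eq_of_lt_of_lt (Finset.mem_range.mp hb) (Finset.mem_range.mp ha))
      · rfl
      · rfl
  · rw [Finset.sum_eq_zero]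
    · simp
    · intro a ha
      split_ifs with h1 h2
      · exact absurd ⟨a, ha, h1, h2⟩ hz
      · rfl
      · rfl

/-! ### Products of cyclotomic polynomials -/

/-- The inverse cyclotomic polynomial `(x ^ n - 1) / Φ_n`. -/
noncomputable def invCyclotomic (n : ℕ) : ℤ[X] := ∏ i ∈ n.properDivisors, cyclotomic i ℤ

/-- The product of the lengths of `Φ_n` and of `(x ^ n - 1) / Φ_n`. -/
noncomputable def lengthProd (n : ℕ) : ℕ := S n * length (invCyclotomic n)

theorem cyclotomic_mul_invCyclotomic {n : ℕ} (hn : 0 < n) :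
    cyclotomic n ℤ * invCyclotomic n = X ^ n - 1 := by
  rw [← prod_cyclotomic_eq_X_pow_sub_one hn, ← Nat.cons_self_properDivisors hn.ne',
    Finset.prod_cons, invCyclotomic]

theorem expand_cyclotomic {p l : ℕ} (hp : p.Prime) (hpl : ¬p ∣ l) :
    expand ℤ p (cyclotomic l ℤ) = cyclotomic (p * l) ℤ * cyclotomic l ℤ := by
  rw [cyclotomic_expand_eq_cyclotomic_mul hp hpl, mul_comm l p]

/-- Substitute x^p in Φ_l Ψ_l = x^l - 1 and use Φ_l(x^p) = Φ_{pl} Φ_l. This is what bounds the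
length of Ψ_{pl} by X_l, independently of p. -/
theorem invCyclotomic_prime_mul {p l : ℕ} (hl : 0 < l) (hp : p.Prime) (hpl : ¬p ∣ l) :
    invCyclotomic (p * l) = cyclotomic l ℤ * expand ℤ p (invCyclotomic l) := by
  refine mul_left_cancel₀ (cyclotomic_ne_zero (p * l) ℤ) ?_
  rw [cyclotomic_mul_invCyclotomic (Nat.mul_pos hp.pos hl), ← mul_assoc, ← expand_cyclotomic hp hpl,
    ← map_mul, cyclotomic_mul_invCyclotomic hl]
  simp [pow_mul]

theorem length_invCyclotomic_prime_mul_le {p l : ℕ} (hl : 0 < l) (hp : p.Prime) (hpl : ¬p ∣ l) :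
    length (invCyclotomic (p * l)) ≤ lengthProd l := by
  rw [invCyclotomic_prime_mul hl hp hpl]
  exact (length_mul_le _ _).trans (Nat.mul_le_mul_left _ (length_expand_le _ _))

theorem invCyclotomic_one : invCyclotomic 1 = 1 := by simp [invCyclotomic]

theorem S_one_le : S 1 ≤ 2 := by
  rw [S, cyclotomic_one]
  refine (length_sub_le _ _).trans ?_
  have := length_X_pow_le 1
  rw [pow_one] at this
  rw [length_one]; omega

theorem S_pos (n : ℕ) : 0 < S n :=
  (height_pos (cyclotomic_ne_zero n ℤ)).trans_le (height_le_length _)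

theorem A_pos (n : ℕ) : 0 < A n := height_pos (cyclotomic_ne_zero n ℤ)

theorem S_prime_le {p : ℕ} (hp : p.Prime) : S p ≤ p := by
  have := Fact.mk hp
  rw [S, cyclotomic_prime]
  refine (length_sum_le _ _).trans ((Finset.sum_le_sum fun i _ => length_X_pow_le i).trans ?_)
  simp

theorem A_prime_le {p : ℕ} (hp : p.Prime) : A p ≤ 1 := by
  have := Fact.mk hp
  refine height_le fun m => ?_
  rw [cyclotomic_prime, finsetSum_coeff]
  simp only [coeff_X_pow]
  rw [Finset.sum_ite_eq]
  split_ifs <;> simp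

theorem lengthProd_one_le : lengthProd 1 ≤ 2 := by
  rw [lengthProd, invCyclotomic_one, length_one, mul_one]
  exact S_one_le

theorem length_invCyclotomic_prime_le {p : ℕ} (hp : p.Prime) : length (invCyclotomic p) ≤ 2 := by
  have h := length_invCyclotomic_prime_mul_le one_pos hp (by simpa using hp.one_lt.ne')
  rw [mul_one] at h
  exact h.trans lengthProd_one_le

theorem lengthProd_prime_le {p : ℕ} (hp : p.Prime) : lengthProd p ≤ p * 2 :=
  Nat.mul_le_mul (S_prime_le hp) (length_invCyclotomic_prime_le hp)

theorem pow_sub_one_mul_geom (m k : ℕ) :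
    (X ^ m - 1 : ℤ[X]) * ∑ a ∈ Finset.range k, X ^ (m * a) = X ^ (m * k) - 1 := by
  simp only [pow_mul]
  exact mul_geom_sum _ _

/-- With m = pl, Φ_{qm} (x^{mq} - 1) = Ψ_m(x) · Φ_m(x^q) · Σ_{a<q} x^{ma}. The last two factors
together have height at most A_m, as no exponents collide. Below degree mq the left side is -Φ_{qm},
and Φ_{qm} has smaller degree than that. -/
theorem A_le_mul_lengthProd {p q l : ℕ} (hl : 0 < l) (hp : p.Prime) (hq : q.Prime)
    (hpl : ¬p ∣ l) (hqpl : ¬q ∣ p * l) : A (q * (p * l)) ≤ lengthProd l * A (p * l) := by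
  set m := p * l with hm
  have hm0 : 0 < m := Nat.mul_pos hp.pos hl
  set G : ℤ[X] := ∑ a ∈ Finset.range q, X ^ (m * a)
  have key : cyclotomic (q * m) ℤ * (X ^ (m * q) - 1) =
      invCyclotomic m * (expand ℤ q (cyclotomic m ℤ) * G) := by
    rw [← pow_sub_one_mul_geom, expand_cyclotomic hq hqpl, ← cyclotomic_mul_invCyclotomic hm0]
    ring
  have hlen : length (invCyclotomic m) ≤ lengthProd l :=
    length_invCyclotomic_prime_mul_le hl hp hpl
  have hH : height (expand ℤ q (cyclotomic m ℤ) * G) ≤ A m :=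
    height_expand_mul_geom_le _ hq.pos ((Nat.Prime.coprime_iff_not_dvd hq).mpr hqpl)
  refine height_le fun N => ?_
  rcases lt_or_ge N (m * q) with hN | hN
  · have hc : (cyclotomic (q * m) ℤ).coeff N =
        -(invCyclotomic m * (expand ℤ q (cyclotomic m ℤ) * G)).coeff N := by
      rw [← key, mul_sub, coeff_sub, coeff_mul_X_pow', if_neg (not_le.mpr hN)]
      simp
    rw [hc, Int.natAbs_neg]
    exact (natAbs_coeff_le_height _ _).trans ((height_mul_le _ _).trans (Nat.mul_le_mul hlen hH))
  · have : (cyclotomic (q * m) ℤ).natDegree < N := by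
      rw [natDegree_cyclotomic]
      refine lt_of_lt_of_le (Nat.totient_lt _ ?_) (by rwa [mul_comm q m])
      exact hq.one_lt.trans_le (Nat.le_mul_of_pos_right _ hm0)
    rw [coeff_eq_zero_of_natDegree_lt this]
    simp

/-- At most half of the lattice points of a `q × p` rectangle satisfy `p a + q b ≤ (p-1)(q-1)`. -/
theorem two_mul_card_filter_le {p q : ℕ} (hp : 2 ≤ p) (hq : 2 ≤ q) :
    2 * ((Finset.range q ×ˢ Finset.range p).filter
      fun x => p * x.1 + q * x.2 ≤ (p - 1) * (q - 1)).card ≤ p * q := by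
  set E := (Finset.range q ×ˢ Finset.range p).filter
      fun x => p * x.1 + q * x.2 ≤ (p - 1) * (q - 1) with hE
  -- The central reflection of the rectangle sends E off itself: the weights of a point and its
  -- image add up to p(q-1) + q(p-1) > 2(p-1)(q-1).
  let φ : ℕ × ℕ → ℕ × ℕ := fun x => (q - 1 - x.1, p - 1 - x.2)
  have hmem : ∀ x ∈ E, x.1 < q ∧ x.2 < p ∧ p * x.1 + q * x.2 ≤ (p - 1) * (q - 1) := by
    intro x hx
    rw [hE, Finset.mem_filter, Finset.mem_product, Finset.mem_range, Finset.mem_range] at hx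
    exact ⟨hx.1.1, hx.1.2, hx.2⟩
  have hinj : Set.InjOn φ E := by
    intro x hx y hy hxy
    have h1 := hmem x hx
    have h2 := hmem y hy
    simp only [φ, Prod.mk.injEq] at hxy
    ext <;> omega
  have hdisj : Disjoint E (E.image φ) := by
    rw [Finset.disjoint_left]
    rintro x hx hx'
    obtain ⟨y, hy, rfl⟩ := Finset.mem_image.mp hx'
    obtain ⟨h1, h2, h3⟩ := hmem y hy
    obtain ⟨-, -, h6⟩ := hmem _ hx
    simp only [φ] at h6
    obtain ⟨a, ha⟩ := Nat.exists_eq_add_of_lt h1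
    obtain ⟨b, hb⟩ := Nat.exists_eq_add_of_lt h2
    have e1 : q - 1 - y.1 = a := by omega
    have e2 : p - 1 - y.2 = b := by omega
    rw [e1, e2] at h6
    obtain ⟨p', rfl⟩ : ∃ p', p = p' + 1 := ⟨p - 1, by omega⟩
    obtain ⟨q', rfl⟩ : ∃ q', q = q' + 1 := ⟨q - 1, by omega⟩
    simp only [Nat.add_sub_cancel] at h3 h6
    have ea : q' = y.1 + a := by omega
    have eb : p' = y.2 + b := by omega
    have : (p' + 1) * q' + (q' + 1) * p' ≤ 2 * (p' * q') := by
      calc (p' + 1) * q' + (q' + 1) * p'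
          = ((p' + 1) * y.1 + (q' + 1) * y.2) + ((p' + 1) * a + (q' + 1) * b) := by
            rw [show (p' + 1) * q' = (p' + 1) * (y.1 + a) by rw [ea],
              show (q' + 1) * p' = (q' + 1) * (y.2 + b) by rw [eb]]
            ring
        _ ≤ 2 * (p' * q') := by omega
    nlinarith
  have hsub : E ∪ E.image φ ⊆ Finset.range q ×ˢ Finset.range p := by
    intro x hx
    rcases Finset.mem_union.mp hx with h | h
    · exact (Finset.mem_filter.mp h).1
    · obtain ⟨y, hy, rfl⟩ := Finset.mem_image.mp h
      simp only [φ, Finset.mem_product, Finset.mem_range]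
      omega
  have := Finset.card_le_card hsub
  rw [Finset.card_union_of_disjoint hdisj, Finset.card_image_of_injOn hinj, Finset.card_product,
    Finset.card_range, Finset.card_range] at this
  linarith [mul_comm p q]

theorem cyclotomic_mul_mul {p q l : ℕ} (hl : 0 < l) (hp : p.Prime) (hq : q.Prime)
    (hpl : ¬p ∣ l) (hqpl : ¬q ∣ p * l) :
    cyclotomic (q * (p * l)) ℤ * (X ^ (l * p) - 1) * (X ^ (l * q) - 1) =
      cyclotomic l ℤ * expand ℤ q (expand ℤ p (cyclotomic l ℤ)) *
        expand ℤ p (invCyclotomic l) * expand ℤ q (invCyclotomic l) := by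
  have e : ∀ r : ℕ, (X ^ (l * r) - 1 : ℤ[X]) =
      expand ℤ r (cyclotomic l ℤ) * expand ℤ r (invCyclotomic l) := by
    intro r
    rw [← map_mul, cyclotomic_mul_invCyclotomic hl, mul_comm l r]
    simp [pow_mul]
  rw [e p, e q]
  have h2 := expand_cyclotomic hp hpl
  rw [h2, map_mul, expand_cyclotomic hq hqpl]
  ring

/-- In `cyclotomic_mul_mul` the two denominators are inverted by geometric sums indexed by lattice
points (a, b). Since deg Φ_{pql} ≤ l(p-1)(q-1), only points with pa + qb ≤ (p-1)(q-1) matter, at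
most half of the rectangle. -/
theorem two_mul_S_le {p q l : ℕ} (hl : 0 < l) (hp : p.Prime) (hq : q.Prime)
    (hpl : ¬p ∣ l) (hqpl : ¬q ∣ p * l) :
    2 * S (q * (p * l)) ≤ p * q * lengthProd l ^ 2 := by
  set E := (Finset.range q ×ˢ Finset.range p).filter
      fun x => p * x.1 + q * x.2 ≤ (p - 1) * (q - 1) with hE
  set N : ℤ[X] := cyclotomic l ℤ * expand ℤ q (expand ℤ p (cyclotomic l ℤ)) *
        expand ℤ p (invCyclotomic l) * expand ℤ q (invCyclotomic l) with hN
  set n := q * (p * l) with hn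
  have hdeg : (cyclotomic n ℤ).natDegree ≤ l * ((p - 1) * (q - 1)) := by
    rw [natDegree_cyclotomic, hn, Nat.totient_mul ((Nat.Prime.coprime_iff_not_dvd hq).mpr hqpl),
      Nat.totient_mul ((Nat.Prime.coprime_iff_not_dvd hp).mpr hpl), Nat.totient_prime hp,
      Nat.totient_prime hq]
    calc (q - 1) * ((p - 1) * l.totient) ≤ (q - 1) * ((p - 1) * l) := by
          gcongr; exact Nat.totient_le l
      _ = _ := by ring
  have hlt : l * ((p - 1) * (q - 1)) < n := by
    rw [hn]
    have h1 := hp.two_le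
    have h2 := hq.two_le
    calc l * ((p - 1) * (q - 1)) < l * (p * q) := by
          refine Nat.mul_lt_mul_of_pos_left ?_ hl
          exact Nat.mul_lt_mul_of_lt_of_le (by omega) (by omega) (by omega)
      _ = _ := by ring
  let ex : ℕ × ℕ → ℕ := fun x => l * p * x.1 + l * q * x.2
  have hfull : N * ∑ x ∈ Finset.range q ×ˢ Finset.range p, X ^ ex x =
      cyclotomic n ℤ * (X ^ n - 1) ^ 2 := by
    have hG : ∑ x ∈ Finset.range q ×ˢ Finset.range p, (X : ℤ[X]) ^ ex x =
        (∑ a ∈ Finset.range q, X ^ (l * p * a)) * ∑ b ∈ Finset.range p, X ^ (l * q * b) := by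
      rw [Finset.sum_mul_sum, Finset.sum_product]
      simp only [ex, pow_add]
    rw [hN, ← cyclotomic_mul_mul hl hp hq hpl hqpl, hG]
    have g1 := pow_sub_one_mul_geom (l * p) q
    have g2 := pow_sub_one_mul_geom (l * q) p
    rw [show l * p * q = n by rw [hn]; ring] at g1
    rw [show l * q * p = n by rw [hn]; ring] at g2
    calc _ = cyclotomic n ℤ * ((X ^ (l * p) - 1) * ∑ a ∈ Finset.range q, X ^ (l * p * a)) *
          ((X ^ (l * q) - 1) * ∑ b ∈ Finset.range p, X ^ (l * q * b)) := by ring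
      _ = _ := by rw [g1, g2]; ring
  have hcoef : ∀ m ≤ (cyclotomic n ℤ).natDegree,
      (cyclotomic n ℤ).coeff m = (N * ∑ x ∈ E, X ^ ex x).coeff m := by
    intro m hm
    have hmn : m < n := (hm.trans hdeg).trans_lt hlt
    -- Modulo x^n the factor (x^n - 1)^2 is 1.
    have h1 : (cyclotomic n ℤ * (X ^ n - 1) ^ 2).coeff m = (cyclotomic n ℤ).coeff m := by
      rw [show cyclotomic n ℤ * (X ^ n - 1) ^ 2 =
        cyclotomic n ℤ * (X ^ n - 2) * X ^ n + cyclotomic n ℤ by ring, coeff_add,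
        coeff_mul_X_pow', if_neg (not_le.mpr hmn), zero_add]
    rw [← h1, ← hfull, Finset.mul_sum, Finset.mul_sum, finsetSum_coeff, finsetSum_coeff]
    symm
    refine Finset.sum_subset (Finset.filter_subset _ _) fun x hx hxE => ?_
    rw [coeff_mul_X_pow', if_neg]
    intro hle
    refine hxE (Finset.mem_filter.mpr ⟨hx, ?_⟩)
    refine Nat.le_of_mul_le_mul_left ?_ hl
    calc l * (p * x.1 + q * x.2) = ex x := by simp only [ex]; ring
      _ ≤ _ := hle.trans (hm.trans hdeg)
  have hNlen : length N ≤ lengthProd l ^ 2 := by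
    have h1 : ∀ r, length (expand ℤ r (invCyclotomic l)) ≤ length (invCyclotomic l) :=
      fun r => length_expand_le r _
    have h2 : length (expand ℤ q (expand ℤ p (cyclotomic l ℤ))) ≤ S l :=
      (length_expand_le _ _).trans (length_expand_le _ _)
    calc length N ≤ S l * S l * length (invCyclotomic l) * length (invCyclotomic l) := by
          rw [hN]
          refine (length_mul_le _ _).trans (Nat.mul_le_mul ?_ (h1 q))
          refine (length_mul_le _ _).trans (Nat.mul_le_mul ?_ (h1 p))
          exact (length_mul_le _ _).trans (Nat.mul_le_mul le_rfl h2)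
      _ = lengthProd l ^ 2 := by rw [lengthProd]; ring
  have hElen : length (∑ x ∈ E, X ^ ex x : ℤ[X]) ≤ E.card := by
    refine (length_sum_le _ _).trans ((Finset.sum_le_sum fun x _ => length_X_pow_le (ex x)).trans ?_)
    simp
  calc 2 * S n ≤ 2 * (lengthProd l ^ 2 * E.card) :=
        Nat.mul_le_mul_left _ ((length_le_of_coeff_eq hcoef).trans
          ((length_mul_le _ _).trans (Nat.mul_le_mul hNlen hElen)))
    _ = (2 * E.card) * lengthProd l ^ 2 := by ring
    _ ≤ _ := Nat.mul_le_mul_right _ (two_mul_card_filter_le hp.two_le hq.two_le)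

/-- Here u and v + 1 are the inverses of p mod q and of q mod p, and Φ_{pq} is a difference of two
products of geometric sums. Taking l = 1 in `two_mul_S_le` would lose the factor `lengthProd 1 ^ 2`;
the sharp form starts the recursion with constant 1. -/
theorem two_mul_S_mul_prime_le {p q : ℕ} (hp : p.Prime) (hq : q.Prime) (hpq : p ≠ q) :
    2 * S (q * p) ≤ p * q := by
  have hcop : p.Coprime q := (Nat.coprime_primes hp hq).mpr hpq
  obtain ⟨u, huq, hu⟩ := Nat.exists_mul_mod_eq_one_of_coprime hcop hq.one_lt
  set t := p * u / q with ht
  have hpu : p * u = q * t + 1 := by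
    have := Nat.div_add_mod (p * u) q
    rw [hu] at this
    exact this.symm
  have htp : t < p := by
    by_contra hge
    have h1 : q * p ≤ q * t := Nat.mul_le_mul_left _ (not_lt.mp hge)
    have h2 : p * u ≤ p * q := Nat.mul_le_mul_left _ huq.le
    nlinarith
  obtain ⟨v, hv⟩ := Nat.exists_eq_add_of_lt htp
  obtain ⟨w, hw⟩ := Nat.exists_eq_add_of_lt huq
  have hv' : p = t + (v + 1) := by omega
  have hw' : q = u + (w + 1) := by omega
  have hsum : p * u + q * (v + 1) = p * q + 1 := by
    have : p * q = q * t + q * (v + 1) := by rw [← mul_add, ← hv', mul_comm]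
    omega
  have hwv : p * (w + 1) + 1 = q * (v + 1) := by
    have : p * q = p * u + p * (w + 1) := by rw [← mul_add, ← hw']
    omega
  set geo : ℕ → ℕ → ℤ[X] := fun m k => ∑ a ∈ Finset.range k, X ^ (m * a) with hgeo
  have hlen : ∀ m k, length (geo m k) ≤ k := fun m k =>
    (length_sum_le _ _).trans ((Finset.sum_le_sum fun a _ => length_X_pow_le (m * a)).trans
      (by simp))
  have hne : ∀ m, 0 < m → (X ^ m - 1 : ℤ[X]) ≠ 0 := fun m hm => by
    simpa using X_pow_sub_C_ne_zero hm (1 : ℤ)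
  have hqp : ¬q ∣ p * 1 := by
    rw [mul_one, Nat.prime_dvd_prime_iff_eq hq hp]; exact hpq.symm
  have hcyc := cyclotomic_mul_mul one_pos hp hq (by simpa using hp.one_lt.ne') hqp
  have hPQ : cyclotomic (q * p) ℤ = geo p u * geo q (v + 1) - X ^ 1 * (geo p (w + 1) * geo q t) := by
    refine mul_right_cancel₀ (mul_ne_zero (hne p hp.pos) (hne q hq.pos)) ?_
    have g1 := pow_sub_one_mul_geom p u
    have g2 := pow_sub_one_mul_geom q (v + 1)
    have g3 := pow_sub_one_mul_geom p (w + 1)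
    have g4 := pow_sub_one_mul_geom q t
    have lhs : cyclotomic (q * p) ℤ * ((X ^ p - 1) * (X ^ q - 1)) =
        (X - 1) * (X ^ (p * q) - 1) := by
      simp only [mul_one, one_mul, invCyclotomic_one, cyclotomic_one, map_one, map_sub, expand_X,
        map_pow] at hcyc
      rw [← mul_assoc, hcyc, mul_comm p q, pow_mul]
    rw [lhs, sub_mul (geo p u * geo q (v + 1))]
    have e1 : geo p u * geo q (v + 1) * ((X ^ p - 1) * (X ^ q - 1)) =
        (X ^ (p * u) - 1) * (X ^ (q * (v + 1)) - 1) := by rw [← g1, ← g2]; ring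
    have e2 : X ^ 1 * (geo p (w + 1) * geo q t) * ((X ^ p - 1) * (X ^ q - 1)) =
        X * ((X ^ (p * (w + 1)) - 1) * (X ^ (q * t) - 1)) := by rw [← g3, ← g4]; ring
    rw [e1, e2, ← hwv, hpu]
    have hpq' : p * q = q * t + 1 + p * (w + 1) := by omega
    rw [hpq']
    ring
  have hS : S (q * p) ≤ u * (v + 1) + (w + 1) * t := by
    rw [S, hPQ]
    refine (length_sub_le _ _).trans (Nat.add_le_add ?_ ?_)
    · exact (length_mul_le _ _).trans (Nat.mul_le_mul (hlen _ _) (hlen _ _))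
    · refine (length_mul_le _ _).trans ?_
      calc _ ≤ 1 * ((w + 1) * t) := Nat.mul_le_mul (length_X_pow_le 1)
            ((length_mul_le _ _).trans (Nat.mul_le_mul (hlen _ _) (hlen _ _)))
        _ = _ := one_mul _
  have h2 : 2 * (u * (v + 1) + (w + 1) * t) ≤ p * q := by
    have hpos : 1 < p * q := by nlinarith [hp.two_le, hq.two_le]
    -- With a = pu and b = q(v+1), so a + b = pq + 1, the claim times pq becomes 2(ab + (a-1)(b-1))
    -- < (a+b-1)(a+b), that is (a-b)^2 + a + b > 2.
    refine Nat.le_of_lt_succ (lt_of_mul_lt_mul_left (a := p * q) ?_ (Nat.zero_le _))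
    zify at hpu hwv hsum hpos ⊢
    generalize hz : (p : ℤ) * u = a at *
    generalize hy : (q : ℤ) * (v + 1) = b at *
    have hc : (p : ℤ) * (w + 1) = b - 1 := by linarith
    have hd : (q : ℤ) * t = a - 1 := by linarith
    have : (p : ℤ) * q * (2 * (u * (v + 1) + (w + 1) * t)) = 2 * (a * b + (b - 1) * (a - 1)) := by
      rw [← hc, ← hd, ← hz, ← hy]; ring
    nlinarith [sq_nonneg (a - b)]
  omega

/-! ### The constants -/

theorem A_mul_prime_mul_prime_le {p q r : ℕ} (hp : p.Prime) (hq : q.Prime) (hr : r.Prime)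
    (hpq : p ≠ q) (hpr : p ≠ r) (hqr : q ≠ r) : A (p * q * r) ≤ 4 * p := by
  have h1 : A (q * p) ≤ 2 := by
    have := A_le_mul_lengthProd one_pos hp hq (by simpa using hp.one_lt.ne')
      (by rw [mul_one, Nat.prime_dvd_prime_iff_eq hq hp]; exact hpq.symm)
    rw [mul_one] at this
    exact this.trans (Nat.mul_le_mul lengthProd_one_le (A_prime_le hp))
  have h2 := A_le_mul_lengthProd hp.pos hq hr
    (by rw [Nat.prime_dvd_prime_iff_eq hq hp]; exact hpq.symm)
    (by
      rw [Nat.Prime.dvd_mul hr, Nat.prime_dvd_prime_iff_eq hr hq, Nat.prime_dvd_prime_iff_eq hr hp]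
      exact not_or.mpr ⟨hqr.symm, hpr.symm⟩)
  rw [show p * q * r = r * (q * p) by ring]
  calc _ ≤ _ := h2
    _ ≤ p * 2 * 2 := Nat.mul_le_mul (lengthProd_prime_le hp) h1
    _ = _ := by ring

theorem epsilonThree_set_nonempty : {e : ℝ | 0 < e ∧ ∀ p q r : ℕ, p.Prime → q.Prime → r.Prime →
    p ≠ q → p ≠ r → q ≠ r → (A (p * q * r) : ℝ) ≤ e * p}.Nonempty :=
  ⟨4, by norm_num, fun _ _ _ hp hq hr h1 h2 h3 => by
    exact_mod_cast A_mul_prime_mul_prime_le hp hq hr h1 h2 h3⟩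

theorem A_le_epsilonThree_mul {p q r : ℕ} (hp : p.Prime) (hq : q.Prime) (hr : r.Prime)
    (hpq : p ≠ q) (hpr : p ≠ r) (hqr : q ≠ r) : (A (p * q * r) : ℝ) ≤ epsilonThree * p := by
  have hp0 : (0 : ℝ) < p := by exact_mod_cast hp.pos
  rw [← div_le_iff₀ hp0]
  exact le_csInf epsilonThree_set_nonempty fun e he =>
    (div_le_iff₀ hp0).mpr (he.2 p q r hp hq hr hpq hpr hqr)

theorem two_le_A_105 : 2 ≤ A 105 := by
  have h := cyclotomic_mul_mul (p := 5) (q := 7) (l := 3) (by norm_num) (by norm_num) (by norm_num)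
    (by norm_num) (by norm_num)
  have hinv : invCyclotomic 3 = X - 1 := by
    rw [invCyclotomic, Nat.Prime.properDivisors Nat.prime_three]
    simp
  rw [hinv] at h
  simp only [cyclotomic_three, map_add, map_sub, map_pow, map_one, expand_X] at h
  norm_num at h
  have h7 : (cyclotomic 105 ℤ).coeff 7 = -2 := by
    have e1 : (cyclotomic 105 ℤ * (X ^ 15 - 1) * (X ^ 21 - 1)).coeff 7 =
        (cyclotomic 105 ℤ).coeff 7 := by
      rw [show cyclotomic 105 ℤ * (X ^ 15 - 1) * (X ^ 21 - 1) =
        cyclotomic 105 ℤ * (X ^ 6 * (X ^ 15 - 1) - 1) * X ^ 15 + cyclotomic 105 ℤ by ring,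
        coeff_add, coeff_mul_X_pow']
      simp
    rw [← e1, h]
    -- Everything of degree at least 12 is collected in one multiple of X^12, so the coefficient -2
    -- of X^7 can be read off.
    rw [show (X ^ 2 + X + 1) * (((X ^ 7) ^ 5) ^ 2 + (X ^ 7) ^ 5 + 1) * (X ^ 5 - 1) * (X ^ 7 - 1) =
      ((X ^ 2 + X + 1) * ((X ^ 58 + X ^ 23) * (X ^ 5 - 1) * (X ^ 7 - 1) + 1)) * X ^ 12
        - (X ^ 1 + 1) * X ^ 8 - 2 * X ^ 7 - X ^ 6 - X ^ 5 + X ^ 2 + X + (1 : ℤ[X]) by ring]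
    simp only [coeff_add, coeff_sub, coeff_mul_X_pow', coeff_X_pow, coeff_X, coeff_one]
    simp
  have := natAbs_coeff_le_height (cyclotomic 105 ℤ) 7
  rw [h7] at this
  exact this

theorem two_thirds_le_epsilonThree : 2 / 3 ≤ epsilonThree := by
  have h := A_le_epsilonThree_mul (p := 3) (q := 5) (r := 7) (by norm_num) (by norm_num)
    (by norm_num) (by norm_num) (by norm_num) (by norm_num)
  have h2 : (2 : ℝ) ≤ A (3 * 5 * 7) := by exact_mod_cast two_le_A_105
  push_cast at h
  linarith

theorem S_div_le_epsilonThree {p q r : ℕ} (hp : p.Prime) (hq : q.Prime) (hr : r.Prime)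
    (hpq : p ≠ q) (hpr : p ≠ r) (hqr : q ≠ r) :
    (S (p * q * r) : ℝ) / ((p : ℝ) ^ 2 * q * r) ≤ epsilonThree := by
  have h0 : (0 : ℝ) < (p : ℝ) ^ 2 * q * r := by
    have := hp.pos; have := hq.pos; have := hr.pos; positivity
  rw [div_le_iff₀ h0]
  have hlt : 1 < p * q * r :=
    hp.one_lt.trans_le ((Nat.le_mul_of_pos_right _ hq.pos).trans (Nat.le_mul_of_pos_right _ hr.pos))
  have h1 : S (p * q * r) ≤ (p * q * r) * A (p * q * r) := by
    refine (length_le_mul_height _).trans (Nat.mul_le_mul_right _ ?_)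
    rw [natDegree_cyclotomic]
    exact Nat.totient_lt _ hlt
  calc (S (p * q * r) : ℝ) ≤ (p * q * r) * A (p * q * r) := by exact_mod_cast h1
    _ ≤ (p * q * r) * (epsilonThree * p) := by
        gcongr; exact A_le_epsilonThree_mul hp hq hr hpq hpr hqr
    _ = _ := by ring

theorem S_le_d_mul {p q r : ℕ} (hp : p.Prime) (hq : q.Prime) (hr : r.Prime)
    (hpq : p ≠ q) (hpr : p ≠ r) (hqr : q ≠ r) :
    (S (p * q * r) : ℝ) ≤ d * ((p : ℝ) ^ 2 * q * r) := by
  have h0 : (0 : ℝ) < (p : ℝ) ^ 2 * q * r := by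
    have := hp.pos; have := hq.pos; have := hr.pos; positivity
  rw [← div_le_iff₀ h0]
  refine le_csSup ⟨epsilonThree, ?_⟩ ⟨p, q, r, hp, hq, hr, hpq, hpr, hqr, rfl⟩
  rintro _ ⟨p, q, r, hp, hq, hr, hpq, hpr, hqr, rfl⟩
  exact S_div_le_epsilonThree hp hq hr hpq hpr hqr

theorem d_le_epsilonThree : d ≤ epsilonThree := by
  refine csSup_le ⟨_, 2, 3, 5, by norm_num, by norm_num, by norm_num, by norm_num, by norm_num,
    by norm_num, rfl⟩ ?_
  rintro _ ⟨p, q, r, hp, hq, hr, hpq, hpr, hqr, rfl⟩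
  exact S_div_le_epsilonThree hp hq hr hpq hpr hqr

theorem d_pos : 0 < d := by
  have h := S_le_d_mul (p := 2) (q := 3) (r := 5) (by norm_num) (by norm_num) (by norm_num)
    (by norm_num) (by norm_num) (by norm_num)
  have h2 : (0 : ℝ) < S (2 * 3 * 5) := by exact_mod_cast S_pos _
  exact pos_of_mul_pos_left (h2.trans_le h) (by positivity)

/-- Every base is at least 5/6 and the exponents 1/2^i add up to 2. -/
theorem exp_two_mul_log_le_rho : Real.exp (2 * Real.log (5 / 6)) ≤ rho := by
  have hbase : ∀ i : ℕ, (5 / 6 : ℝ) ≤ (2 * (i : ℝ) + 5) / (2 * (i : ℝ) + 6) ∧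
      (2 * (i : ℝ) + 5) / (2 * (i : ℝ) + 6) ≤ 1 := fun i => by
    have hi : (0 : ℝ) ≤ i := i.cast_nonneg
    constructor
    · rw [div_le_div_iff₀ (by norm_num) (by positivity)]; linarith
    · rw [div_le_one (by positivity)]; linarith
  have hpos : ∀ i : ℕ, 0 < (2 * (i : ℝ) + 5) / (2 * (i : ℝ) + 6) := fun i => by positivity
  have hlog : ∀ i : ℕ, Real.log (((2 * (i : ℝ) + 5) / (2 * (i : ℝ) + 6)) ^ ((1 : ℝ) / 2 ^ i)) =
      (1 / 2) ^ i * Real.log ((2 * (i : ℝ) + 5) / (2 * (i : ℝ) + 6)) := fun i => by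
    rw [Real.log_rpow (hpos i), one_div_pow]
  have hlow : ∀ i : ℕ, (1 / 2 : ℝ) ^ i * Real.log (5 / 6) ≤
      Real.log (((2 * (i : ℝ) + 5) / (2 * (i : ℝ) + 6)) ^ ((1 : ℝ) / 2 ^ i)) := fun i => by
    rw [hlog]
    exact mul_le_mul_of_nonneg_left (Real.log_le_log (by norm_num) (hbase i).1) (by positivity)
  have hgeo : HasSum (fun i : ℕ => (1 / 2 : ℝ) ^ i * Real.log (5 / 6)) (2 * Real.log (5 / 6)) :=
    hasSum_geometric_two.mul_right _
  have hsum : Summable fun i : ℕ =>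
      Real.log (((2 * (i : ℝ) + 5) / (2 * (i : ℝ) + 6)) ^ ((1 : ℝ) / 2 ^ i)) := by
    rw [← summable_neg_iff]
    refine Summable.of_nonneg_of_le (fun i => ?_) (fun i => neg_le_neg (hlow i)) hgeo.summable.neg
    rw [hlog, ← mul_neg]
    exact mul_nonneg (by positivity)
      (neg_nonneg.mpr (Real.log_nonpos (hpos i).le (hbase i).2))
  rw [rho, ← Real.rexp_tsum_eq_tprod (fun i => Real.rpow_pos_of_pos (hpos i) _) hsum,
    Real.exp_le_exp, ← hgeo.tsum_eq]
  exact hgeo.summable.tsum_le_tsum hlow hsum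

/-- After inserting d ≤ ε₃, ε₃ ≥ 2/3 and ρ ≥ (5/6)^2, the powers of 2 cancel and the claim reduces
to 3^4 ≤ 5^3. -/
theorem exp_log_d_div_le_C : Real.exp (Real.log (d / 2) / 24) ≤ C := by
  have he : 0 < epsilonThree := lt_of_lt_of_le (by norm_num) two_thirds_le_epsilonThree
  have hd := d_pos
  have hrho : 0 < rho := (Real.exp_pos _).trans_le exp_two_mul_log_le_rho
  have h1 : Real.log (2 / 3) ≤ Real.log epsilonThree :=
    Real.log_le_log (by norm_num) two_thirds_le_epsilonThree
  have h2 : Real.log d ≤ Real.log epsilonThree := Real.log_le_log hd d_le_epsilonThree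
  have h3 : 2 * Real.log (5 / 6) ≤ Real.log rho :=
    (Real.le_log_iff_exp_le hrho).mpr exp_two_mul_log_le_rho
  have hC : Real.log C = 1 / 32 * (Real.log (3 / 4) + 3 / 2 * Real.log epsilonThree +
      Real.log d + 1 / 4 * Real.log rho) := by
    rw [C, Real.log_rpow (by positivity), Real.log_mul (by positivity) (by positivity),
      Real.log_mul (by positivity) (by positivity), Real.log_mul (by positivity) (by positivity),
      Real.log_rpow he, Real.log_rpow hrho]
  have hCpos : 0 < C := by rw [C]; positivity
  rw [← Real.le_log_iff_exp_le hCpos, hC, Real.log_div hd.ne' (by norm_num)]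
  have h4 : 4 * Real.log 3 ≤ 3 * Real.log 5 := by
    have : Real.log ((3 : ℝ) ^ 4) ≤ Real.log ((5 : ℝ) ^ 3) :=
      Real.log_le_log (by norm_num) (by norm_num)
    rw [Real.log_pow, Real.log_pow] at this
    exact_mod_cast this
  have l4 : Real.log 4 = 2 * Real.log 2 := by
    rw [show (4 : ℝ) = 2 ^ 2 by norm_num, Real.log_pow]; norm_num
  have l6 : Real.log 6 = Real.log 2 + Real.log 3 := by
    rw [← Real.log_mul (by norm_num) (by norm_num)]; norm_num
  rw [Real.log_div (by norm_num) (by norm_num)] at h1 h3 ⊢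
  rw [l6] at h3
  rw [l4]
  linarith

/-! ### Bounds along lists of primes -/

/-- The product of the `p_i ^ (2 ^ i)` for a list `p_0, p_1, …`. -/
def powProd : List ℕ → ℕ
  | [] => 1
  | m :: t => m * powProd t ^ 2

/-- The monomial in the primes `t` that bounds `S t.prod` up to a constant. -/
def lengthMonomial : List ℕ → ℕ
  | [] => 1
  | m :: t => m * powProd t

theorem not_dvd_prod_of_notMem {p : ℕ} {t : List ℕ} (hp : p.Prime) (ht : ∀ q ∈ t, q.Prime)
    (h : p ∉ t) : ¬p ∣ t.prod :=
  fun hd => h (mem_list_primes_of_dvd_prod hp.prime (fun q hq => (ht q hq).prime) hd)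

theorem prod_pos_of_prime {t : List ℕ} (ht : ∀ q ∈ t, q.Prime) : 0 < t.prod :=
  List.prod_pos fun q hq => (ht q hq).pos

theorem S_cons_cons_le {p q : ℕ} {t : List ℕ} (hn : (q :: p :: t).Nodup)
    (hpr : ∀ r ∈ q :: p :: t, r.Prime) :
    (S (q :: p :: t).prod : ℝ) ≤ p * q * (lengthProd t.prod : ℝ) ^ 2 / 2 := by
  have hpt : ∀ r ∈ p :: t, r.Prime := fun r hr => hpr r (List.mem_cons_of_mem _ hr)
  have ht : ∀ r ∈ t, r.Prime := fun r hr => hpt r (List.mem_cons_of_mem _ hr)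
  have hq : q.Prime := hpr q (by simp)
  have hp : p.Prime := hpr p (by simp)
  have hn' := List.nodup_cons.mp hn
  have h := two_mul_S_le (prod_pos_of_prime ht) hp hq
    (not_dvd_prod_of_notMem hp ht (List.nodup_cons.mp hn'.2).1)
    (by rw [← List.prod_cons]; exact not_dvd_prod_of_notMem hq hpt hn'.1)
  rw [List.prod_cons, List.prod_cons, le_div_iff₀ (by norm_num), mul_comm]
  exact_mod_cast h

theorem lengthProd_cons_le {p : ℕ} {t : List ℕ} (hn : (p :: t).Nodup)
    (hpr : ∀ r ∈ p :: t, r.Prime) :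
    (lengthProd (p :: t).prod : ℝ) ≤ S (p :: t).prod * lengthProd t.prod := by
  have ht : ∀ r ∈ t, r.Prime := fun r hr => hpr r (List.mem_cons_of_mem _ hr)
  have hp : p.Prime := hpr p (by simp)
  have := length_invCyclotomic_prime_mul_le (prod_pos_of_prime ht) hp
    (not_dvd_prod_of_notMem hp ht (List.nodup_cons.mp hn).1)
  rw [lengthProd, List.prod_cons]
  exact_mod_cast Nat.mul_le_mul_left _ this

theorem S_pair_le {p q : ℕ} (hn : [q, p].Nodup) (hpr : ∀ r ∈ [q, p], r.Prime) :
    (S [q, p].prod : ℝ) ≤ p * q / 2 := by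
  have hp : p.Prime := hpr p (by simp)
  have hq : q.Prime := hpr q (by simp)
  have hne : q ≠ p := by simpa using hn
  have h := two_mul_S_mul_prime_le hp hq hne.symm
  rw [le_div_iff₀ (by norm_num), mul_comm, List.prod_cons, List.prod_singleton]
  exact_mod_cast h

theorem S_triple_le {p q r : ℕ} (hn : [r, q, p].Nodup) (hpr : ∀ s ∈ [r, q, p], s.Prime) :
    (S [r, q, p].prod : ℝ) ≤ d * (r * (q * p ^ 2)) := by
  have hp : p.Prime := hpr p (by simp)
  have hq : q.Prime := hpr q (by simp)
  have hr : r.Prime := hpr r (by simp)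
  have hn' : (r ≠ q ∧ r ≠ p) ∧ q ≠ p := by simpa using hn
  have h := S_le_d_mul hp hq hr hn'.2.symm hn'.1.2.symm hn'.1.1.symm
  rw [List.prod_cons, List.prod_cons, List.prod_singleton, show r * (q * p) = p * q * r by ring]
  exact h.trans_eq (by ring)

theorem lengthProd_pair_le {p q : ℕ} (hn : [q, p].Nodup) (hpr : ∀ r ∈ [q, p], r.Prime) :
    (lengthProd [q, p].prod : ℝ) ≤ q * p ^ 2 := by
  have hp : p.Prime := hpr p (by simp)
  have h1 : (lengthProd [p].prod : ℝ) ≤ p * 2 := by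
    rw [List.prod_singleton]; exact_mod_cast lengthProd_prime_le hp
  calc (lengthProd [q, p].prod : ℝ) ≤ S [q, p].prod * lengthProd [p].prod :=
        lengthProd_cons_le hn hpr
    _ ≤ (p * q / 2) * (p * 2) := by gcongr; exact S_pair_le hn hpr
    _ = _ := by ring

/-- The exponential rate of the length of `Φ_n · (x ^ n - 1) / Φ_n`. -/
noncomputable def rate : ℝ := Real.log (d / 2) / 12

/-- The oscillating part of the exponent in `lengthProd_le_exp_mul_powProd`. -/
noncomputable def osc : ℝ := -(Real.log 2 / 2) - 4 * rate

/-- The exponent solves x_{j+2} = x_{j+1} + 2 x_j - log 2: a fixed point (log 2)/2 plus multiples of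
2^j and (-1)^j. The values x_2 = 0 and x_3 = log d determine `rate` and `osc`. -/
theorem lengthProd_le_exp_mul_powProd (t : List ℕ) (h2 : 2 ≤ t.length) (hn : t.Nodup)
    (hpr : ∀ r ∈ t, r.Prime) :
    (lengthProd t.prod : ℝ) ≤
      Real.exp (Real.log 2 / 2 + rate * 2 ^ t.length + osc * (-1) ^ t.length) * powProd t := by
  match t, h2 with
  | [q, p], _ =>
    have e : Real.log 2 / 2 + rate * 2 ^ [q, p].length + osc * (-1) ^ [q, p].length = 0 := by
      simp only [List.length_cons, List.length_nil, osc]; ring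
    rw [e, Real.exp_zero, one_mul]
    refine (lengthProd_pair_le hn hpr).trans_eq ?_
    simp [powProd]
  | [r, q, p], _ =>
    have e : Real.log 2 / 2 + rate * 2 ^ [r, q, p].length + osc * (-1) ^ [r, q, p].length =
        Real.log d := by
      have : rate * 12 = Real.log d - Real.log 2 := by
        rw [rate, Real.log_div d_pos.ne' (by norm_num)]; ring
      simp only [List.length_cons, List.length_nil, osc]
      linarith
    have hn' := (List.nodup_cons.mp hn).2
    have hpr' : ∀ s ∈ [q, p], s.Prime := fun s hs => hpr s (List.mem_cons_of_mem _ hs)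
    rw [e, Real.exp_log d_pos]
    have hd := d_pos.le
    calc (lengthProd [r, q, p].prod : ℝ) ≤ S [r, q, p].prod * lengthProd [q, p].prod :=
          lengthProd_cons_le hn hpr
      _ ≤ (d * (r * (q * p ^ 2))) * (q * p ^ 2) := by
          gcongr
          · exact S_triple_le hn hpr
          · exact lengthProd_pair_le hn' hpr'
      _ = d * powProd [r, q, p] := by simp [powProd]; ring
  | q :: p :: s :: s' :: t, _ =>
    set u := s :: s' :: t with hu
    have hn1 := (List.nodup_cons.mp hn).2
    have hn2 := (List.nodup_cons.mp hn1).2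
    have hpr1 : ∀ s ∈ p :: u, s.Prime := fun s hs => hpr s (List.mem_cons_of_mem _ hs)
    have hpr2 : ∀ s ∈ u, s.Prime := fun s hs => hpr1 s (List.mem_cons_of_mem _ hs)
    have i1 := lengthProd_le_exp_mul_powProd (p :: u) (by simp [hu]) hn1 hpr1
    have i2 := lengthProd_le_exp_mul_powProd u (by simp [hu]) hn2 hpr2
    rw [show (p :: u).length = u.length + 1 from rfl] at i1
    rw [show (q :: p :: u).length = u.length + 1 + 1 from rfl]
    set j := u.length
    set E1 := Real.log 2 / 2 + rate * 2 ^ (j + 1) + osc * (-1) ^ (j + 1)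
    set E2 := Real.log 2 / 2 + rate * 2 ^ j + osc * (-1) ^ j
    have hE : Real.exp (Real.log 2 / 2 + rate * 2 ^ (j + 1 + 1) + osc * (-1) ^ (j + 1 + 1)) =
        Real.exp E2 ^ 2 * Real.exp E1 / 2 := by
      rw [eq_div_iff (by norm_num), ← Real.exp_nat_mul, ← Real.exp_add]
      refine (congrArg (_ * ·) (Real.exp_log (show (0 : ℝ) < 2 by norm_num)).symm).trans ?_
      rw [← Real.exp_add]
      congr 1
      simp only [E1, E2]
      push_cast
      ring
    rw [hE]
    calc (lengthProd (q :: p :: u).prod : ℝ)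
        ≤ S (q :: p :: u).prod * lengthProd (p :: u).prod := lengthProd_cons_le hn hpr
      _ ≤ (p * q * (lengthProd u.prod : ℝ) ^ 2 / 2) * lengthProd (p :: u).prod := by
          gcongr; exact S_cons_cons_le hn hpr
      _ ≤ (p * q * (Real.exp E2 * powProd u) ^ 2 / 2) * (Real.exp E1 * powProd (p :: u)) := by
          gcongr
      _ = _ := by simp only [powProd]; push_cast; ring
termination_by t.length

/-- A cruder bound valid for all lengths, sufficient for the single factor A_n. -/
theorem exists_lengthProd_le : ∃ K : ℝ, 0 ≤ K ∧ ∀ t : List ℕ, t.Nodup → (∀ r ∈ t, r.Prime) →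
    (lengthProd t.prod : ℝ) ≤ Real.exp (K * 2 ^ t.length) * powProd t := by
  have hl : 0 ≤ Real.log 2 := Real.log_nonneg (by norm_num)
  refine ⟨Real.log 2 + |rate| + |osc|, by positivity, fun t hn hpr => ?_⟩
  have hone : ∀ n : ℕ, Real.log 2 ≤ (Real.log 2 + |rate| + |osc|) * 2 ^ n := fun n => by
    have h1 : (1 : ℝ) ≤ 2 ^ n := one_le_pow₀ (by norm_num)
    nlinarith [abs_nonneg rate, abs_nonneg osc]
  have htwo : ∀ n : ℕ, 2 ≤ Real.exp ((Real.log 2 + |rate| + |osc|) * 2 ^ n) := fun n => by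
    rw [← Real.log_le_iff_le_exp (by norm_num)]; exact hone n
  match t, hn, hpr with
  | [], _, _ =>
    have : (lengthProd 1 : ℝ) ≤ 2 := by exact_mod_cast lengthProd_one_le
    simpa [powProd] using this.trans (htwo 0)
  | [p], _, hpr =>
    have hp : p.Prime := hpr p (by simp)
    have : (lengthProd p : ℝ) ≤ p * 2 := by exact_mod_cast lengthProd_prime_le hp
    have h1 : (p : ℝ) * 2 ≤ p * Real.exp ((Real.log 2 + |rate| + |osc|) * 2 ^ 1) := by
      gcongr; exact htwo 1
    simpa [powProd, mul_comm] using this.trans h1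
  | q :: p :: t, hn, hpr =>
    refine (lengthProd_le_exp_mul_powProd _ (by simp) hn hpr).trans ?_
    gcongr
    set j := (q :: p :: t).length
    have h1 : (1 : ℝ) ≤ 2 ^ j := one_le_pow₀ (by norm_num)
    have h2 : rate * 2 ^ j ≤ |rate| * 2 ^ j := by gcongr; exact le_abs_self _
    have h3 : osc * (-1) ^ j ≤ |osc| := by
      refine (le_abs_self _).trans ?_
      rw [abs_mul, abs_pow, abs_neg, abs_one, one_pow, mul_one]
    nlinarith [abs_nonneg osc]

theorem exists_S_le : ∃ K : ℝ, ∀ t : List ℕ, t.Nodup → (∀ r ∈ t, r.Prime) →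
    (S t.prod : ℝ) ≤ Real.exp (rate / 2 * 2 ^ t.length + K) * lengthMonomial t := by
  have hl : 0 ≤ Real.log 2 := Real.log_nonneg (by norm_num)
  refine ⟨2 * |osc| + 8 * |rate| + |Real.log d| + Real.log 2, fun t hn hpr => ?_⟩
  have ho := abs_nonneg osc
  have hr := abs_nonneg rate
  have hd := abs_nonneg (Real.log d)
  have hr1 := neg_abs_le rate
  have hd1 := le_abs_self (Real.log d)
  match t, hn, hpr with
  | [], _, _ =>
    have : (S 1 : ℝ) ≤ 2 := by exact_mod_cast S_one_le
    simp only [List.prod_nil, List.length_nil, lengthMonomial, Nat.cast_one, mul_one]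
    refine this.trans ((Real.log_le_iff_le_exp (by norm_num)).mp ?_)
    linarith
  | [p], _, hpr =>
    have hp : p.Prime := hpr p (by simp)
    have : (S p : ℝ) ≤ p := by exact_mod_cast S_prime_le hp
    simp only [List.prod_singleton, List.length_singleton, lengthMonomial, powProd, mul_one]
    refine this.trans (le_mul_of_one_le_left p.cast_nonneg (Real.one_le_exp ?_))
    linarith
  | [q, p], hn, hpr =>
    have h0 : (S [q, p].prod : ℝ) ≤ lengthMonomial [q, p] := by
      refine (S_pair_le hn hpr).trans ?_
      have : (0 : ℝ) ≤ p * q := by positivity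
      simp only [lengthMonomial, powProd]
      push_cast
      linarith
    refine h0.trans (le_mul_of_one_le_left (Nat.cast_nonneg _) (Real.one_le_exp ?_))
    simp only [List.length_cons, List.length_nil]
    linarith
  | [r, q, p], hn, hpr =>
    have h0 : (S [r, q, p].prod : ℝ) ≤ d * lengthMonomial [r, q, p] := by
      refine (S_triple_le hn hpr).trans_eq ?_
      simp [lengthMonomial, powProd]
    refine h0.trans (mul_le_mul_of_nonneg_right ?_ (Nat.cast_nonneg _))
    refine (Real.log_le_iff_le_exp d_pos).mp ?_
    simp only [List.length_cons, List.length_nil]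
    linarith
  | q :: p :: s :: s' :: t, hn, hpr =>
    set u := s :: s' :: t with hu
    have hn2 := (List.nodup_cons.mp (List.nodup_cons.mp hn).2).2
    have hpr2 : ∀ s ∈ u, s.Prime := fun s hs =>
      hpr s (List.mem_cons_of_mem _ (List.mem_cons_of_mem _ hs))
    have i2 := lengthProd_le_exp_mul_powProd u (by simp [hu]) hn2 hpr2
    rw [show (q :: p :: u).length = u.length + 1 + 1 from rfl]
    set j := u.length
    set E2 := Real.log 2 / 2 + rate * 2 ^ j + osc * (-1) ^ j
    have hE : Real.exp E2 ^ 2 / 2 = Real.exp (rate / 2 * 2 ^ (j + 1 + 1) + 2 * (osc * (-1) ^ j)) := by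
      rw [div_eq_iff (by norm_num), ← Real.exp_nat_mul]
      refine Eq.trans ?_ (congrArg (_ * ·) (Real.exp_log (show (0 : ℝ) < 2 by norm_num)))
      rw [← Real.exp_add]
      congr 1
      simp only [E2]
      push_cast
      ring
    have h3 : osc * (-1) ^ j ≤ |osc| := by
      refine (le_abs_self _).trans ?_
      rw [abs_mul, abs_pow, abs_neg, abs_one, one_pow, mul_one]
    calc (S (q :: p :: u).prod : ℝ) ≤ p * q * (lengthProd u.prod : ℝ) ^ 2 / 2 :=
          S_cons_cons_le hn hpr
      _ ≤ p * q * (Real.exp E2 * powProd u) ^ 2 / 2 := by gcongr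
      _ = (Real.exp E2 ^ 2 / 2) * lengthMonomial (q :: p :: u) := by
          simp only [lengthMonomial, powProd]; push_cast; ring
      _ ≤ _ := by
          rw [hE]
          gcongr
          linarith

theorem exists_A_mul_le : ∃ K : ℝ, 0 ≤ K ∧ ∀ t : List ℕ, t ≠ [] → t.Nodup →
    (∀ r ∈ t, r.Prime) →
    (A t.prod : ℝ) * t.prod ≤ Real.exp (K * 2 ^ t.length) * lengthMonomial t := by
  obtain ⟨K, hK, hX⟩ := exists_lengthProd_le
  -- The bound does not involve the head m. In the inductive step X_t and the inductive bound each
  -- contribute exp(K 2^j) `powProd t`, which squares both.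
  have main : ∀ (t : List ℕ) (m : ℕ), (m :: t).Nodup → (∀ r ∈ m :: t, r.Prime) →
      (A (m :: t).prod : ℝ) * t.prod ≤ Real.exp (K * 2 ^ t.length) * powProd t := by
    intro t
    induction t with
    | nil =>
      intro m _ hpr
      have : (A m : ℝ) ≤ 1 := by exact_mod_cast A_prime_le (hpr m (by simp))
      simpa [powProd] using this.trans (Real.one_le_exp hK)
    | cons p t ih =>
      intro q hn hpr
      have hpt : ∀ r ∈ p :: t, r.Prime := fun r hr => hpr r (List.mem_cons_of_mem _ hr)
      have ht : ∀ r ∈ t, r.Prime := fun r hr => hpt r (List.mem_cons_of_mem _ hr)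
      have hq : q.Prime := hpr q (by simp)
      have hp : p.Prime := hpr p (by simp)
      have hn' := List.nodup_cons.mp hn
      have hn2 := List.nodup_cons.mp hn'.2
      have h := A_le_mul_lengthProd (prod_pos_of_prime ht) hp hq
        (not_dvd_prod_of_notMem hp ht hn2.1)
        (by rw [← List.prod_cons]; exact not_dvd_prod_of_notMem hq hpt hn'.1)
      rw [← List.prod_cons, ← List.prod_cons] at h
      have h' : (A (q :: p :: t).prod : ℝ) ≤ lengthProd t.prod * A (p :: t).prod := by
        exact_mod_cast h
      calc (A (q :: p :: t).prod : ℝ) * (p :: t).prod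
          ≤ (lengthProd t.prod * A (p :: t).prod) * (p :: t).prod := by gcongr
        _ = p * lengthProd t.prod * (A (p :: t).prod * t.prod) := by
            rw [List.prod_cons]; push_cast; ring
        _ ≤ p * (Real.exp (K * 2 ^ t.length) * powProd t) *
              (Real.exp (K * 2 ^ t.length) * powProd t) := by
            exact mul_le_mul (mul_le_mul_of_nonneg_left (hX t hn2.2 ht) p.cast_nonneg)
              (ih p hn'.2 hpt) (by positivity) (by positivity)
        _ = Real.exp (K * 2 ^ (p :: t).length) * powProd (p :: t) := by
            rw [List.length_cons, pow_succ, ← mul_assoc K, mul_two, Real.exp_add, powProd]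
            push_cast; ring
  refine ⟨K, hK, fun t => ?_⟩
  cases t with
  | nil => intro h; exact absurd rfl h
  | cons m t =>
    intro _ hn hpr
    calc (A (m :: t).prod : ℝ) * (m :: t).prod = m * (A (m :: t).prod * t.prod) := by
          rw [List.prod_cons]; push_cast; ring
      _ ≤ m * (Real.exp (K * 2 ^ t.length) * powProd t) := 
          mul_le_mul_of_nonneg_left (main t m hn hpr) m.cast_nonneg
      _ = Real.exp (K * 2 ^ t.length) * lengthMonomial (m :: t) := by
          rw [lengthMonomial]; push_cast; ring
      _ ≤ _ := by
          gcongr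
          · norm_num
          · simp

/-! ### Sums over sublists and over divisors -/

theorem sum_sublists'_cons (f : List ℕ → ℝ) (m : ℕ) (t : List ℕ) :
    ((m :: t).sublists'.map f).sum =
      (t.sublists'.map f).sum + (t.sublists'.map fun s => f (m :: s)).sum := by
  simp [List.sublists'_cons, Function.comp_def]

theorem sum_sublists'_add (f g : List ℕ → ℝ) (t : List ℕ) :
    (t.sublists'.map fun s => f s + g s).sum =
      (t.sublists'.map f).sum + (t.sublists'.map g).sum :=
  List.sum_map_add

theorem sum_sublists'_const (c : ℝ) (t : List ℕ) :
    (t.sublists'.map fun _ => c).sum = 2 ^ t.length * c := by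
  simp

/-- The binomial theorem for (1 + 2)^k; this is where 3^k comes from. -/
theorem sum_sublists'_mul_two_pow (c : ℝ) (t : List ℕ) :
    (t.sublists'.map fun s => c * 2 ^ s.length).sum = c * 3 ^ t.length := by
  induction t with
  | nil => simp
  | cons m t ih =>
    rw [sum_sublists'_cons, ih]
    simp only [List.length_cons, pow_succ, ← mul_assoc, List.sum_map_mul_right] at ih ⊢
    rw [ih]; ring

theorem powProd_pos {t : List ℕ} (ht : ∀ p ∈ t, 0 < p) : 0 < powProd t := by
  induction t with
  | nil => exact one_pos
  | cons m t ih =>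
    have := ih fun p hp => ht p (List.mem_cons_of_mem _ hp)
    exact Nat.mul_pos (ht m (by simp)) (pow_pos this 2)

theorem lengthMonomial_pos {t : List ℕ} (ht : ∀ p ∈ t, 0 < p) : 0 < lengthMonomial t := by
  cases t with
  | nil => exact one_pos
  | cons m t =>
    exact Nat.mul_pos (ht m (by simp)) (powProd_pos fun p hp => ht p (List.mem_cons_of_mem _ hp))

/-- The sum of `log (powProd s)` over the sublists `s` of `t`. -/
noncomputable def sumLogPowProd (t : List ℕ) : ℝ :=
  (t.sublists'.map fun s => Real.log (powProd s)).sum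

/-- The sum of `log (lengthMonomial s)` over the sublists `s` of `t`. -/
noncomputable def sumLogLengthMonomial (t : List ℕ) : ℝ :=
  (t.sublists'.map fun s => Real.log (lengthMonomial s)).sum

theorem log_powProd_cons {m : ℕ} {s : List ℕ} (hm : 0 < m) (hs : ∀ p ∈ s, 0 < p) :
    Real.log (powProd (m :: s)) = Real.log m + 2 * Real.log (powProd s) := by
  have h1 : (m : ℝ) ≠ 0 := by exact_mod_cast hm.ne'
  have h2 : (powProd s : ℝ) ≠ 0 := by exact_mod_cast (powProd_pos hs).ne'
  rw [powProd]
  push_cast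
  rw [Real.log_mul h1 (pow_ne_zero 2 h2), Real.log_pow]
  norm_num

theorem log_lengthMonomial_cons {m : ℕ} {s : List ℕ} (hm : 0 < m) (hs : ∀ p ∈ s, 0 < p) :
    Real.log (lengthMonomial (m :: s)) = Real.log m + Real.log (powProd s) := by
  have h1 : (m : ℝ) ≠ 0 := by exact_mod_cast hm.ne'
  have h2 : (powProd s : ℝ) ≠ 0 := by exact_mod_cast (powProd_pos hs).ne'
  rw [lengthMonomial]
  push_cast
  rw [Real.log_mul h1 h2]

theorem sumLogPowProd_cons {m : ℕ} {t : List ℕ} (hm : 0 < m) (ht : ∀ p ∈ t, 0 < p) :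
    sumLogPowProd (m :: t) = 3 * sumLogPowProd t + 2 ^ t.length * Real.log m := by
  have h : (t.sublists'.map fun s => Real.log (powProd (m :: s))) =
      t.sublists'.map fun s => Real.log m + 2 * Real.log (powProd s) :=
    List.map_congr_left fun s hs => log_powProd_cons hm fun p hp =>
      ht p ((List.mem_sublists'.mp hs).subset hp)
  rw [sumLogPowProd, sum_sublists'_cons, h, sum_sublists'_add, sum_sublists'_const,
    List.sum_map_mul_left, ← sumLogPowProd]
  ring

theorem sumLogLengthMonomial_cons {m : ℕ} {t : List ℕ} (hm : 0 < m) (ht : ∀ p ∈ t, 0 < p) :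
    sumLogLengthMonomial (m :: t) =
      sumLogLengthMonomial t + (2 ^ t.length * Real.log m + sumLogPowProd t) := by
  have h : (t.sublists'.map fun s => Real.log (lengthMonomial (m :: s))) =
      t.sublists'.map fun s => Real.log m + Real.log (powProd s) :=
    List.map_congr_left fun s hs => log_lengthMonomial_cons hm fun p hp =>
      ht p ((List.mem_sublists'.mp hs).subset hp)
  rw [sumLogLengthMonomial, sum_sublists'_cons, h, sum_sublists'_add, sum_sublists'_const,
    ← sumLogPowProd, ← sumLogLengthMonomial]

/-! ### Chebyshev's inequality for decreasing lists -/

theorem log_prod_cons {m : ℕ} {t : List ℕ} (hm : 0 < m) (ht : ∀ p ∈ t, 0 < p) :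
    Real.log (m :: t).prod = Real.log m + Real.log t.prod := by
  rw [List.prod_cons, Nat.cast_mul, Real.log_mul]
  · exact_mod_cast hm.ne'
  · exact_mod_cast (List.prod_pos ht).ne'

theorem log_prod_le {m : ℕ} {t : List ℕ} (hle : ∀ p ∈ t, p ≤ m) (ht : ∀ p ∈ t, 0 < p) :
    Real.log t.prod ≤ t.length * Real.log m := by
  induction t with
  | nil => simp
  | cons p t ih =>
    have ht' := fun q hq => ht q (List.mem_cons_of_mem _ hq)
    have hp : 0 < p := ht p (by simp)
    rw [log_prod_cons hp ht', List.length_cons]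
    have h1 := ih (fun q hq => hle q (List.mem_cons_of_mem _ hq)) ht'
    have h2 : Real.log p ≤ Real.log m :=
      Real.log_le_log (by exact_mod_cast hp) (by exact_mod_cast hle p (by simp))
    rw [Nat.cast_succ]
    linarith

theorem succ_mul_two_pow_le (j : ℕ) : ((j : ℝ) + 1) * 2 ^ j ≤ 3 * 3 ^ j - 2 * 2 ^ j := by
  induction j with
  | zero => norm_num
  | succ j ih =>
    have : (0 : ℝ) ≤ j * 2 ^ j := by positivity
    have h3 : (0 : ℝ) < 2 ^ j := by positivity
    push_cast
    rw [pow_succ, pow_succ]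
    nlinarith

theorem two_mul_succ_mul_two_pow_le (j : ℕ) : 2 * ((j : ℝ) + 1) * 2 ^ j ≤ 3 * 3 ^ j - 1 := by
  rcases j with - | j
  · norm_num
  · induction j with
    | zero => norm_num
    | succ j ih =>
      have : (0 : ℝ) ≤ j * 2 ^ j := by positivity
      rw [pow_succ 3, pow_succ 2]
      push_cast at ih ⊢
      have h3 : (0 : ℝ) < 2 ^ (j + 1) := by positivity
      have h4 : (0 : ℝ) ≤ j * 2 ^ (j + 1) := by positivity
      nlinarith

/-- Chebyshev's inequality for the exponents of `∏ powProd s`. -/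
theorem length_mul_sumLogPowProd_le {t : List ℕ} (hs : t.Pairwise (· ≥ ·)) (ht : ∀ p ∈ t, 0 < p) :
    t.length * sumLogPowProd t ≤ (3 ^ t.length - 2 ^ t.length) * Real.log t.prod := by
  induction t with
  | nil => simp
  | cons m t ih =>
    have ht' := fun q hq => ht q (List.mem_cons_of_mem _ hq)
    have hm : 0 < m := ht m (by simp)
    obtain ⟨hmt, hs'⟩ := List.pairwise_cons.mp hs
    have h1 := ih hs' ht'
    have h2 := log_prod_le hmt ht'
    rw [sumLogPowProd_cons hm ht', log_prod_cons hm ht', List.length_cons]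
    rcases t.eq_nil_or_concat with rfl | hne
    · simp [sumLogPowProd, powProd]; norm_num
    have hj : (0 : ℝ) < t.length := by
      obtain ⟨s, a, rfl⟩ := hne
      simp; positivity
    have hc := succ_mul_two_pow_le t.length
    refine le_of_mul_le_mul_left ?_ hj
    rw [pow_succ, pow_succ, Nat.cast_succ]
    generalize (t.length : ℝ) = j at *
    -- The head's exponent 2^j is at most the mean exponent, while log m is at least the mean of the
    -- logarithms of the tail.
    have k1 := mul_nonneg (sub_nonneg.mpr hc) (sub_nonneg.mpr h2)
    have k2 := mul_nonneg (add_pos hj one_pos).le (sub_nonneg.mpr h1)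
    linarith

/-- Chebyshev's inequality for the exponents of `∏ lengthMonomial s`. -/
theorem length_mul_sumLogLengthMonomial_le {t : List ℕ} (hs : t.Pairwise (· ≥ ·))
    (ht : ∀ p ∈ t, 0 < p) :
    2 * t.length * sumLogLengthMonomial t ≤ (3 ^ t.length - 1) * Real.log t.prod := by
  induction t with
  | nil => simp
  | cons m t ih =>
    have ht' := fun q hq => ht q (List.mem_cons_of_mem _ hq)
    have hm : 0 < m := ht m (by simp)
    obtain ⟨hmt, hs'⟩ := List.pairwise_cons.mp hs
    have h1 := ih hs' ht'
    have h2 := log_prod_le hmt ht'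
    have h3 := length_mul_sumLogPowProd_le hs' ht'
    rw [sumLogLengthMonomial_cons hm ht', log_prod_cons hm ht', List.length_cons]
    rcases t.eq_nil_or_concat with rfl | hne
    · simp [sumLogPowProd, powProd, sumLogLengthMonomial, lengthMonomial]; norm_num
    have hj : (0 : ℝ) < t.length := by
      obtain ⟨s, a, rfl⟩ := hne
      simp; positivity
    have hc := two_mul_succ_mul_two_pow_le t.length
    refine le_of_mul_le_mul_left ?_ hj
    rw [pow_succ, Nat.cast_succ]
    generalize (t.length : ℝ) = j at *
    have k1 := mul_nonneg (sub_nonneg.mpr hc) (sub_nonneg.mpr h2)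
    have k2 := mul_nonneg (add_pos hj one_pos).le (sub_nonneg.mpr h1)
    have k3 := mul_nonneg (add_pos hj one_pos).le (sub_nonneg.mpr h3)
    linarith

/-! ### Divisors of a squarefree number as sublists of its primes -/

open scoped Pointwise in
theorem sum_divisors_prime_mul {p N : ℕ} (hp : p.Prime) (hpN : ¬p ∣ N) (f : ℕ → ℝ) :
    ∑ i ∈ (p * N).divisors, f i = ∑ i ∈ N.divisors, f i + ∑ i ∈ N.divisors, f (p * i) := by
  rw [Nat.divisors_mul, hp.divisors, Finset.insert_eq, Finset.union_mul, Finset.singleton_mul,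
    Finset.singleton_mul, ← Finset.image_smul, ← Finset.image_smul, Finset.sum_union, Finset.sum_image, Finset.sum_image]
  · simp
  · intro x _ y _ h
    exact Nat.eq_of_mul_eq_mul_left hp.pos h
  · intro x _ y _ h
    simpa using h
  · rw [Finset.disjoint_left]
    intro x hx hx'
    obtain ⟨y, hy, rfl⟩ := Finset.mem_image.mp hx
    obtain ⟨z, -, hz⟩ := Finset.mem_image.mp hx'
    simp only [smul_eq_mul, one_mul] at hz
    exact hpN ((Dvd.intro _ hz).trans (Nat.dvd_of_mem_divisors hy))

theorem sum_divisors_prod {t : List ℕ} (hn : t.Nodup) (hpr : ∀ p ∈ t, p.Prime) (f : ℕ → ℝ) :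
    ∑ i ∈ t.prod.divisors, f i = (t.sublists'.map fun s => f s.prod).sum := by
  induction t generalizing f with
  | nil => simp
  | cons p t ih =>
    have hpt := fun q hq => hpr q (List.mem_cons_of_mem _ hq)
    have hp := hpr p (by simp)
    obtain ⟨h1, h2⟩ := List.nodup_cons.mp hn
    rw [List.prod_cons, sum_divisors_prime_mul hp (not_dvd_prod_of_notMem hp hpt h1),
      sum_sublists'_cons, ih h2 hpt, ih h2 hpt fun i => f (p * i)]
    simp only [List.prod_cons]

/-! ### Divisors of `x ^ n - 1` -/

theorem exists_unit_mul_prod_of_dvd {ι R : Type*} [CommRing R] [IsDomain R] (s : Finset ι)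
    (f : ι → R) (hf : ∀ i ∈ s, Prime (f i)) {g : R} (h : g ∣ ∏ i ∈ s, f i) :
    ∃ D ⊆ s, ∃ u : R, IsUnit u ∧ g = u * ∏ i ∈ D, f i := by
  classical
  induction s using Finset.induction_on generalizing g with
  | empty => exact ⟨∅, subset_rfl, g, isUnit_of_dvd_one (by simpa using h), by simp⟩
  | insert a s ha ih =>
    have hfs : ∀ i ∈ s, Prime (f i) := fun i hi => hf i (Finset.mem_insert_of_mem hi)
    have hfa : Prime (f a) := hf a (Finset.mem_insert_self a s)
    obtain ⟨c, hc⟩ := h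
    rw [Finset.prod_insert ha] at hc
    rcases hfa.dvd_or_dvd (Dvd.intro _ hc) with ⟨g', rfl⟩ | ⟨c', rfl⟩
    · rw [mul_assoc] at hc
      obtain ⟨D, hD, u, hu, rfl⟩ := ih hfs (Dvd.intro _ (mul_left_cancel₀ hfa.ne_zero hc).symm)
      refine ⟨insert a D, Finset.insert_subset_insert a hD, u, hu, ?_⟩
      rw [Finset.prod_insert fun h => ha (hD h)]
      ring
    · rw [mul_left_comm] at hc
      obtain ⟨D, hD, u, hu, rfl⟩ := ih hfs (Dvd.intro _ (mul_left_cancel₀ hfa.ne_zero hc).symm)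
      exact ⟨D, hD.trans (Finset.subset_insert a s), u, hu, rfl⟩

theorem length_le_one_of_isUnit {u : ℤ[X]} (hu : IsUnit u) : length u ≤ 1 := by
  obtain ⟨r, hr, rfl⟩ := Polynomial.isUnit_iff.mp hu
  have := length_monomial_mul_le 0 r 1
  rwa [mul_one, length_one, mul_one, Int.natAbs_of_isUnit hr, monomial_zero_left] at this

theorem height_le_of_dvd {n : ℕ} (hn : 0 < n) {g : ℤ[X]} (h : g ∣ X ^ n - 1) :
    height g ≤ A n * ∏ i ∈ n.properDivisors, S i := by
  rw [← prod_cyclotomic_eq_X_pow_sub_one hn] at h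
  obtain ⟨D, hD, u, hu, rfl⟩ := exists_unit_mul_prod_of_dvd _ _ (fun i hi =>
    (cyclotomic.irreducible (Nat.pos_of_mem_divisors hi)).prime) h
  have hle : ∀ E ⊆ n.properDivisors, ∏ i ∈ E, S i ≤ ∏ i ∈ n.properDivisors, S i := fun E hE =>
    Finset.prod_le_prod_of_subset_of_one_le' hE fun i _ _ => S_pos i
  have hproper : D.erase n ⊆ n.properDivisors := fun i hi => by
    obtain ⟨h1, h2⟩ := Finset.mem_erase.mp hi
    have := Nat.dvd_of_mem_divisors (hD h2)
    exact Nat.mem_properDivisors.mpr ⟨this, lt_of_le_of_ne (Nat.le_of_dvd hn this) h1⟩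
  have hu1 := length_le_one_of_isUnit hu
  by_cases hnD : n ∈ D
  · rw [← Finset.mul_prod_erase _ _ hnD, mul_comm (cyclotomic n ℤ), ← mul_assoc, mul_comm (A n)]
    refine (height_mul_le _ _).trans (Nat.mul_le_mul_right _ ?_)
    calc length (u * ∏ i ∈ D.erase n, cyclotomic i ℤ) ≤ 1 * ∏ i ∈ D.erase n, S i :=
          (length_mul_le _ _).trans (Nat.mul_le_mul hu1 (length_prod_le _ _))
      _ ≤ _ := by rw [one_mul]; exact hle _ hproper
  · rw [Finset.erase_eq_of_notMem hnD] at hproper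
    calc height (u * ∏ i ∈ D, cyclotomic i ℤ) ≤ length (u * ∏ i ∈ D, cyclotomic i ℤ) :=
          height_le_length _
      _ ≤ 1 * ∏ i ∈ D, S i := (length_mul_le _ _).trans (Nat.mul_le_mul hu1 (length_prod_le _ _))
      _ ≤ 1 * ∏ i ∈ n.properDivisors, S i := Nat.mul_le_mul_left _ (hle _ hproper)
      _ ≤ _ := Nat.mul_le_mul_right _ (A_pos n)

theorem B_le {n : ℕ} (hn : 0 < n) : B n ≤ A n * ∏ i ∈ n.properDivisors, S i := by
  refine csSup_le ⟨_, 1, one_dvd _, rfl⟩ ?_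
  rintro _ ⟨g, hg, rfl⟩
  exact height_le_of_dvd hn hg

theorem B_pos {n : ℕ} (hn : 0 < n) : 0 < B n := by
  refine (height_pos (f := 1) one_ne_zero).trans_le (le_csSup ⟨A n * ∏ i ∈ n.properDivisors, S i, ?_⟩ ⟨1, one_dvd _, rfl⟩)
  rintro _ ⟨g, hg, rfl⟩
  exact height_le_of_dvd hn hg

/-! ### The bound for `B n` -/

theorem exists_log_B_le : ∃ K : ℝ, ∀ n k : ℕ, 1 < n → Squarefree n → n.primeFactors.card = k →
    Real.log (B n) ≤ rate / 2 * 3 ^ k + K * 2 ^ k +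
      (((3 : ℝ) ^ k - 1) / (2 * k) - 1) * Real.log n := by
  obtain ⟨K₁, hS⟩ := exists_S_le
  obtain ⟨K₂, hK₂, hA⟩ := exists_A_mul_le
  refine ⟨K₁ + |K₁| + K₂ + |rate|, fun n k hn hsq hk => ?_⟩
  set L := n.primeFactors.sort (· ≥ ·) with hL
  have hLn : L.Nodup := Finset.sort_nodup _ _
  have hLp : ∀ p ∈ L, p.Prime := fun p hp =>
    Nat.prime_of_mem_primeFactors ((Finset.mem_sort _).mp hp)
  have hLlen : L.length = k := by rw [hL, Finset.length_sort, hk]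
  have hLs : L.Pairwise (· ≥ ·) := Finset.pairwise_sort _ _
  have hLprod : L.prod = n := by
    have h := List.prod_toFinset (fun p : ℕ => p) hLn
    rw [hL, Finset.sort_toFinset, Nat.prod_primeFactors_of_squarefree hsq] at h
    simpa using h.symm
  have hLpos : ∀ p ∈ L, 0 < p := fun p hp => (hLp p hp).pos
  have hn0 : 0 < n := by omega
  have hk0 : 0 < k := by
    rw [← hk, Finset.card_pos, Nat.nonempty_primeFactors]; exact hn
  set E : ℝ := (K₂ + |rate|) * 2 ^ k + |K₁| with hE
  -- At i = n the value log(n A_n), lowered by the error E = O(2^k), obeys the same bound as log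
  -- S_i, so one sum over all sublists covers every factor.
  let f : ℕ → ℝ := fun i => if i = n then Real.log (A n) + Real.log n - E else Real.log (S i)
  have hf : ∀ s ∈ L.sublists', f s.prod ≤
      (rate / 2 * 2 ^ s.length + K₁) + Real.log (lengthMonomial s) := by
    intro s hs
    have hsL := List.mem_sublists'.mp hs
    have hsn : s.Nodup := hsL.nodup hLn
    have hsp : ∀ p ∈ s, p.Prime := fun p hp => hLp p (hsL.subset hp)
    have hW : (0 : ℝ) < lengthMonomial s := by
      exact_mod_cast lengthMonomial_pos fun p hp => (hsp p hp).pos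
    by_cases h : s.prod = n
    · have hne : s ≠ [] := by
        rintro rfl
        simp at h
        omega
      have h1 := hA s hne hsn hsp
      rw [h] at h1
      have hA0 : (0 : ℝ) < A n := by exact_mod_cast A_pos n
      have hnr : (0 : ℝ) < n := by exact_mod_cast hn0
      have h2 := Real.log_le_log (mul_pos hA0 hnr) h1
      rw [Real.log_mul hA0.ne' hnr.ne', Real.log_mul (Real.exp_pos _).ne' hW.ne',
        Real.log_exp] at h2
      simp only [f, if_pos h]
      have h3 : (2 : ℝ) ^ s.length ≤ 2 ^ k :=
        pow_le_pow_right₀ (by norm_num) (hLlen ▸ hsL.length_le)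
      have h4 : (0 : ℝ) < 2 ^ s.length := by positivity
      have h5 : K₂ * 2 ^ s.length ≤ K₂ * 2 ^ k := mul_le_mul_of_nonneg_left h3 hK₂
      have h6 : |rate| * 2 ^ s.length ≤ |rate| * 2 ^ k :=
        mul_le_mul_of_nonneg_left h3 (abs_nonneg _)
      have h7 : -(|rate| * 2 ^ s.length) ≤ rate / 2 * 2 ^ s.length := by
        rw [← neg_mul]
        refine mul_le_mul_of_nonneg_right ?_ h4.le
        linarith [neg_abs_le rate, abs_nonneg rate]
      have h8 := neg_abs_le K₁
      rw [hE]
      linarith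
    · simp only [f, if_neg h]
      have h1 := Real.log_le_log (by exact_mod_cast S_pos _) (hS s hsn hsp)
      rwa [Real.log_mul (Real.exp_pos _).ne' hW.ne', Real.log_exp] at h1
  have hsum : ∑ i ∈ n.divisors, f i ≤
      rate / 2 * 3 ^ k + 2 ^ k * K₁ + sumLogLengthMonomial L := by
    have h1 := sum_divisors_prod hLn hLp f
    rw [hLprod] at h1
    rw [h1]
    refine (List.sum_le_sum hf).trans_eq ?_
    rw [sum_sublists'_add, sum_sublists'_add, sum_sublists'_mul_two_pow, sum_sublists'_const,
      hLlen, sumLogLengthMonomial]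
  have hsplit : ∑ i ∈ n.divisors, f i =
      Real.log (A n) + Real.log n - E + ∑ i ∈ n.properDivisors, Real.log (S i) := by
    rw [← Nat.cons_self_properDivisors hn0.ne', Finset.sum_cons]
    congr 1
    · simp only [f, if_pos]
    · refine Finset.sum_congr rfl fun i hi => ?_
      simp only [f, if_neg (Nat.mem_properDivisors.mp hi).2.ne]
  have hB : Real.log (B n) ≤ Real.log (A n) + ∑ i ∈ n.properDivisors, Real.log (S i) := by
    have hA0 : (A n : ℝ) ≠ 0 := by exact_mod_cast (A_pos n).ne'
    have hS0 : ∀ i ∈ n.properDivisors, (S i : ℝ) ≠ 0 := fun i _ => by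
      exact_mod_cast (S_pos i).ne'
    rw [← Real.log_prod hS0, ← Real.log_mul hA0 (Finset.prod_ne_zero_iff.mpr hS0)]
    exact Real.log_le_log (by exact_mod_cast B_pos hn0) (by exact_mod_cast B_le hn0)
  have hcheb := length_mul_sumLogLengthMonomial_le hLs hLpos
  rw [hLlen, hLprod] at hcheb
  have hkr : (0 : ℝ) < 2 * k := by positivity
  have hF : sumLogLengthMonomial L ≤ ((3 : ℝ) ^ k - 1) / (2 * k) * Real.log n := by
    rw [div_mul_eq_mul_div, le_div_iff₀ hkr]
    linarith
  have hone : |K₁| ≤ |K₁| * 2 ^ k :=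
    le_mul_of_one_le_right (abs_nonneg _) (one_le_pow₀ (by norm_num))
  have hE' : E = K₂ * 2 ^ k + |rate| * 2 ^ k + |K₁| := by rw [hE]; ring
  linarith

end CyclotomicHeight

theorem theorem3 :
    ∃ ξ : ℕ → ℝ, Tendsto ξ atTop (𝓝 0) ∧ (∀ k : ℕ, 0 < CyclotomicHeight.C + ξ k) ∧
      ∀ (n k : ℕ), 1 < n → Squarefree n → n.primeFactors.card = k →
        ∀ η : ℝ, (CyclotomicHeight.B n : ℝ) =
            η * (n : ℝ) ^ (((3 : ℝ) ^ k - 1) / (2 * (k : ℝ)) - 1) →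
          Real.log η < (3 : ℝ) ^ k * Real.log (CyclotomicHeight.C + ξ k) := by
  obtain ⟨K, hK⟩ := CyclotomicHeight.exists_log_B_le
  set r := CyclotomicHeight.rate / 2 with hr
  set c := CyclotomicHeight.C
  have hrC : Real.exp r ≤ c := by
    have : r = Real.log (CyclotomicHeight.d / 2) / 24 := by
      rw [hr, CyclotomicHeight.rate]; ring
    rw [this]
    exact CyclotomicHeight.exp_log_d_div_le_C
  -- After multiplication by 3^k the middle term is the error K 2^k and the last is 1, which makes
  -- the inequality strict.
  let g : ℕ → ℝ := fun k => Real.exp (r + K * (2 / 3) ^ k + (1 / 3) ^ k)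
  have hg : Tendsto g atTop (𝓝 (Real.exp r)) := by
    refine (Real.continuous_exp.tendsto _).comp ?_
    have h1 := (tendsto_pow_atTop_nhds_zero_of_lt_one (r := (2 / 3 : ℝ)) (by norm_num)
      (by norm_num)).const_mul K
    have h2 := tendsto_pow_atTop_nhds_zero_of_lt_one (r := (1 / 3 : ℝ)) (by norm_num) (by norm_num)
    simpa using (h1.const_add r).add h2
  have hge : ∀ k, g k ≤ c + max 0 (g k - c) := fun k => by
    have := le_max_right 0 (g k - c)
    linarith
  -- Then C + ξ_k = max(C, g_k), and ξ_k → 0 because g_k tends to exp r ≤ C.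
  refine ⟨fun k => max 0 (g k - c), ?_, fun k => (Real.exp_pos _).trans_le (hge k), ?_⟩
  · have h := (tendsto_const_nhds (x := (0 : ℝ))).max (hg.sub_const c)
    rwa [max_eq_left (sub_nonpos.mpr hrC)] at h
  · intro n k hn hsq hk η hη
    have hn0 : (0 : ℝ) < n := by exact_mod_cast (by omega : 0 < n)
    have hB0 : (0 : ℝ) < CyclotomicHeight.B n := by
      exact_mod_cast CyclotomicHeight.B_pos (by omega)
    have hpow := Real.rpow_pos_of_pos hn0 (((3 : ℝ) ^ k - 1) / (2 * (k : ℝ)) - 1)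
    have hη0 : 0 < η := pos_of_mul_pos_left (hη ▸ hB0) hpow.le
    have h1 := hK n k hn hsq hk
    rw [hη, Real.log_mul hη0.ne' hpow.ne', Real.log_rpow hn0] at h1
    have h2 : Real.log (g k) ≤ Real.log (c + max 0 (g k - c)) :=
      Real.log_le_log (Real.exp_pos _) (hge k)
    have h3 : (3 : ℝ) ^ k * Real.log (g k) = r * 3 ^ k + K * 2 ^ k + 1 := by
      simp only [g]
      rw [Real.log_exp, div_pow, div_pow, one_pow]
      field_simp
    have h4 := mul_le_mul_of_nonneg_left h2 (by positivity : (0 : ℝ) ≤ 3 ^ k)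
    linarith
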